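/- Let $n$ and $r\ge 1$ be integers, let $n_1,\dots,n_r\ge 1$ be integers with $\bar n:=\sum_{k=1}^r n_k\le n$, and let $0\le q\le p_k\le 1$ for $k=1,\dots,r$. Consider partitions of $\{1,\dots,n\}$ into sets $V_0,V_1,\dots,V_r$ with $|V_k|=n_k$ for $k=1,\dots,r$; the $n-\bar n$ nodes of $V_0$ (possibly none) are called isolated and $V_1,\dots,V_r$ are the communities. The clustering matrix of such a partition is the matrix $Y^\star\in\{0,1\}^{n\times n}$ with $Y^\star_{ij}=1$ if and only if $i,j\in V_k$ for some $k\in\{1,\dots,r\}$; let $\mathcal Y$ denote the set of these matrices. In the heterogenous stochastic block model one observes the symmetric adjacency matrix $A\in\{0,1\}^{n\times n}$ with zero diagonal of a random graph whose edges $\{i,j\}$, $i\neq j$, are present independently, with probability $p_k$ if $i,j\in V_k$ for some $k\in\{1,\dots,r\}$, and with probability $q$ otherwise. Write $$\widetilde D(s,t)=\frac{(s-t)^2}{t(1-t)}\qquad(0<t<1),$$ $p_{\min}=\min_k p_k$, $p_{\max}=\max_k p_k$, $n_{\min}=\min_{1\le k\le r} n_k$; $\log$ is the natural logarithm. Suppose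 that at least one of the following three conditions holds. (1) $0<q<1$, $2\le n_k\le n/e$ for all $k$, and $$4\sum_{k=1}^r n_k^2\,\widetilde D(p_k,q)\le \tfrac12\sum_{k=1}^r n_k\log\tfrac{n}{n_k}-r-2.$$ (2) $p_{\max}<1$, $2\le n_k\le n/e$ for all $k$, and $$\tfrac12 r+\log\tfrac{1-p_{\min}}{1-p_{\max}}+1+\sum_{k=1}^r n_k^2p_k\le\Big(\tfrac14\bar n-\sum_{k=1}^r n_k^2p_k\Big)\log n+\sum_{k=1}^r\big(n_kp_k-\tfrac14\big)n_k\log n_k.$$ (3) $q>0$, $p_{\max}<1$, $n\ge128$, $2\le r<n$, and $$\max_{k}\;n_k\big(\widetilde D(p_k,q)+\widetilde D(q,p_k)\big)\le\tfrac1{12}\log(n-n_{\min}).$$ Then $$\inf_{\hat Y}\ \sup_{Y^\star\in\mathcal Y}\ \mathbb P[\hat Y\ne Y^\star]\ \ge\ \tfrac12,$$ where the infimum is over all measurable estimators $\hat Y=\hat Y(A)\in\{0,1\}^{n\times n}$ (which may depend on $n,r$, all $n_k$, $p_k$ and $q$), and the supremum is over all partitions as above, $Y^\star$ being the clustering matrix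 of the partition that generates $A$. -/

import Mathlib

open MeasureTheory
open scoped ENNReal

namespace HSBM

/-- The Bernoulli distribution `Ber(t)` on `{0, 1}`, for `t ∈ [0, 1]`. -/
noncomputable def ber (t : ℝ) : Measure (Fin 2) :=
  ENNReal.ofReal t • Measure.dirac 1 + ENNReal.ofReal (1 - t) • Measure.dirac 0

/-- The chi-square divergence `(s - t)² / (t (1 - t))` between `Ber(s)` and `Ber(t)`,
for `0 < t < 1`. -/
noncomputable def chiSq (s t : ℝ) : ℝ := (s - t) ^ 2 / (t * (1 - t))

/-- A community assignment of `n` nodes: `z i = some k` if node `i` lies in the community `V k`,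
and `z i = none` if it is isolated, i.e. lies in `V₀`. -/
abbrev Assignment (n r : ℕ) : Type := Fin n → Option (Fin r)

/-- The assignments with `|V k| = N k` for every `k` (so `|V₀| = n - ∑ k, N k`). -/
def assignments (n : ℕ) {r : ℕ} (N : Fin r → ℕ) : Set (Assignment n r) :=
  {z | ∀ k, (Finset.univ.filter fun i => z i = some k).card = N k}

/-- The clustering matrix `∑ k, 1_{V k × V k}` of an assignment. -/
def clusteringMatrix {n r : ℕ} (z : Assignment n r) : Matrix (Fin n) (Fin n) (Fin 2) :=
  Matrix.of fun i j => if ∃ k, z i = some k ∧ z j = some k then 1 else 0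

/-- The probability of an edge between `i` and `j`: it is `p k` if both nodes lie in `V k`,
and `q` otherwise. -/
def edgeProb {n r : ℕ} (p : Fin r → ℝ) (q : ℝ) (z : Assignment n r) (i j : Fin n) : ℝ :=
  match z i with
  | none => q
  | some k => if z j = some k then p k else q

/-- The pairs of nodes `i < j`. -/
abbrev Pair (n : ℕ) : Type := {e : Fin n × Fin n // e.1 < e.2}

/-- The law of the edge indicators of the heterogenous stochastic block model with assignment `z`:
they are independent Bernoulli variables. -/
noncomputable def edgeLaw {n r : ℕ} (p : Fin r → ℝ) (q : ℝ) (z : Assignment n r) :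
    Measure (Pair n → Fin 2) :=
  Measure.pi fun e => ber (edgeProb p q z e.1.1 e.1.2)

/-- The symmetric adjacency matrix, with zero diagonal, of the graph with edge indicators `ω`. -/
def adjacency {n : ℕ} (ω : Pair n → Fin 2) : Matrix (Fin n) (Fin n) (Fin 2) :=
  Matrix.of fun i j =>
    if h : i < j then ω ⟨(i, j), h⟩ else if h : j < i then ω ⟨(j, i), h⟩ else 0

/-- The probability that the estimator `Yhat`, applied to the adjacency matrix of a graph drawn
from the model with assignment `z`, differs from the clustering matrix of `z`. -/
noncomputable def errorProb {n r : ℕ} (p : Fin r → ℝ) (q : ℝ)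
    (Yhat : Matrix (Fin n) (Fin n) (Fin 2) → Matrix (Fin n) (Fin n) (Fin 2))
    (z : Assignment n r) : ℝ≥0∞ :=
  edgeLaw p q z {ω | Yhat (adjacency ω) ≠ clusteringMatrix z}

/-- The minimax error probability over all measurable estimators (every map between these finite
spaces is measurable) and all assignments with the prescribed community sizes. -/
noncomputable def minimaxError (n : ℕ) {r : ℕ} (N : Fin r → ℕ) (p : Fin r → ℝ) (q : ℝ) : ℝ≥0∞ :=
  ⨅ Yhat : Matrix (Fin n) (Fin n) (Fin 2) → Matrix (Fin n) (Fin n) (Fin 2),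
    ⨆ z ∈ assignments n N, errorProb p q Yhat z

end HSBM

/-!
The three conditions are all instances of Fano's inequality. Take a uniform prior on a finite family
of assignments in which no clustering matrix has frequency above `1 / M`, and let every edge law of
the family be at Kullback–Leibler divergence at most `K` from one fixed product of Bernoulli laws.
Then every estimator succeeds with average probability at most `(K + log 2) / log M`, which is at
most `1 / 2` as soon as `2 K + 2 log 2 ≤ log M` (`HSBM.half_le_minimaxError`). The divergence between
product laws is the sum of the divergences over the pairs of nodes.

Under the first two conditions the family consists of all relabellings of the nodes of one
assignment. A clustering matrix determines the assignment up to a permutation of the communities, so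
that `M = n! / (r! n₀! ∏ N k !)` is admissible, where `n₀` is the number of isolated nodes, and
elementary factorial estimates give `log M ≥ 1 / 2 ∑ N k log (n / N k) - r - 2 + 2 log 2`
(`HSBM.log_card_clusterings_ge`). Under the first condition the reference law gives every edge the
probability `q`, and the divergence is bounded by the chi-square divergence. Under the second one the
reference probability is `t = q + ∑ N k ^ 2 p k / n ^ 2 ≤ 1 / 4`: since `p k (N k / n) ^ 2 ≤ t`, a
pair inside the `k`-th community costs at most `2 p k log (n / N k)`, and the other costs amount to
`O(t - q)` for each pair (`HSBM.half_le_minimaxError_of_sparse`).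

Under the third condition the family is obtained from one assignment by exchanging a fixed node `v`
with each node that is not interchangeable with `v`. As there are at least two classes of
interchangeable nodes, `v` can be chosen such that there are at least `n / 2` such nodes; they yield
distinct clustering matrices (`HSBM.eq_of_clusteringMatrix_swap_eq`). An exchange alters only the
edges at the two nodes concerned, and its divergence is at most
`2 max (N k (D(p k, q) + D(q, p k)))`, where `D` is the chi-square divergence
(`HSBM.sum_klBer_swap_le`).
-/

namespace HSBM

/-! ### Fano's inequality on a finite sample space -/

/-- Fano's inequality: if no value of `Y` has frequency above `1 / M`, then for some `i` the guess
`φ` of `Y i` succeeds with probability at most `(K + log 2) / log M` under `f i`. Here `ℓ i` is the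
log-likelihood ratio of `f i` with respect to `g`, known through `f i * exp (-ℓ i) ≤ g` only, so that
its values at the zeros of `f i` and `g` do not matter. -/
theorem exists_mul_success_le {ι Ω β : Type*} [Fintype ι] [Nonempty ι] [Fintype Ω] [DecidableEq β]
    (f ℓ : ι → Ω → ℝ) (g : Ω → ℝ) (hf : ∀ i ω, 0 ≤ f i ω) (hf1 : ∀ i, ∑ ω, f i ω = 1)
    (hg : ∀ ω, 0 ≤ g ω) (hg1 : ∑ ω, g ω = 1)
    (hfg : ∀ i ω, f i ω * Real.exp (-ℓ i ω) ≤ g ω) (Y : ι → β) (φ : Ω → β)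
    {M : ℝ} (hM1 : 1 ≤ M)
    (hM : ∀ y, ((Finset.univ.filter fun i => Y i = y).card : ℝ) * M ≤ Fintype.card ι)
    {K : ℝ} (hK : ∀ i, ∑ ω, f i ω * ℓ i ω ≤ K) :
    ∃ i, Real.log M * ∑ ω with φ ω = Y i, f i ω ≤ K + Real.log 2 := by
  classical
  by_contra! hcon
  -- the tilting function of the Donsker–Varadhan inequality: `M` on the success event, `1` off it
  let h : ι → Ω → ℝ := fun i ω => if φ ω = Y i then M else 1
  have hpos : ∀ i ω, 0 < h i ω := fun i ω => by
    dsimp only [h]; split_ifs <;> linarith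
  have key : ∀ i ω, f i ω * (Real.log (h i ω) - ℓ i ω - Real.log 2)
      ≤ g ω * h i ω / 2 - f i ω := by
    intro i ω
    have h1 : Real.log (h i ω) - ℓ i ω - Real.log 2
        = Real.log (h i ω * Real.exp (-ℓ i ω) / 2) := by
      have := (hpos i ω).ne'
      rw [Real.log_div (by positivity) (by norm_num), Real.log_mul this (by positivity),
        Real.log_exp]
      ring
    have h2 : 0 < h i ω * Real.exp (-ℓ i ω) / 2 := by
      have := hpos i ω
      positivity
    -- summed over `ω`, `log x ≤ x - 1` is the Donsker–Varadhan inequality with the normalising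
    -- constant `2` common to all `i`
    have h3 := Real.log_le_sub_one_of_pos h2
    rw [h1]
    have h4 := mul_le_mul_of_nonneg_left h3 (hf i ω)
    have h5 := mul_le_mul_of_nonneg_right (hfg i ω) (hpos i ω).le
    nlinarith
  have hsum : ∑ i, ∑ ω, g ω * h i ω ≤ 2 * Fintype.card ι := by
    rw [Finset.sum_comm]
    have : ∀ ω, ∑ i, g ω * h i ω ≤ g ω * (2 * Fintype.card ι) := by
      intro ω
      rw [← Finset.mul_sum]
      refine mul_le_mul_of_nonneg_left ?_ (hg ω)
      have e1 : ∀ i, h i ω ≤ 1 + (if Y i = φ ω then M else 0) := fun i => by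
        dsimp only [h]
        by_cases hh : φ ω = Y i
        · simp [hh]
        · rw [if_neg hh, if_neg (Ne.symm hh)]; simp
      refine (Finset.sum_le_sum fun i _ => e1 i).trans ?_
      rw [Finset.sum_add_distrib, ← Finset.sum_filter]
      simp only [Finset.sum_const, nsmul_eq_mul, mul_one, Finset.card_univ]
      linarith [hM (φ ω)]
    refine (Finset.sum_le_sum fun ω _ => this ω).trans ?_
    rw [← Finset.sum_mul, hg1, one_mul]
  have hi : ∀ i, Real.log M * ∑ ω with φ ω = Y i, f i ω - ∑ ω, f i ω * ℓ i ω - Real.log 2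
      ≤ (∑ ω, g ω * h i ω) / 2 - 1 := by
    intro i
    have h1 := Finset.sum_le_sum fun ω (_ : ω ∈ Finset.univ) => key i ω
    have h2 : ∑ ω, f i ω * (Real.log (h i ω) - ℓ i ω - Real.log 2)
        = Real.log M * ∑ ω with φ ω = Y i, f i ω - ∑ ω, f i ω * ℓ i ω - Real.log 2 := by
      have h3 : ∀ ω, f i ω * (Real.log (h i ω) - ℓ i ω - Real.log 2)
          = (if φ ω = Y i then Real.log M * f i ω else 0) - f i ω * ℓ i ω
            - f i ω * Real.log 2 := by
        intro ω
        dsimp only [h]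
        split_ifs
        · ring
        · rw [Real.log_one]; ring
      rw [Finset.sum_congr rfl fun ω _ => h3 ω, Finset.sum_sub_distrib, Finset.sum_sub_distrib,
        ← Finset.sum_filter, ← Finset.mul_sum, ← Finset.sum_mul, hf1, one_mul]
    rw [h2, Finset.sum_sub_distrib, hf1, ← Finset.sum_div] at h1
    exact h1
  have h0 : 0 < ∑ i, (Real.log M * ∑ ω with φ ω = Y i, f i ω
      - ∑ ω, f i ω * ℓ i ω - Real.log 2) :=
    Finset.sum_pos (fun i _ => by linarith [hcon i, hK i]) Finset.univ_nonempty
  have h1 := Finset.sum_le_sum fun i (_ : i ∈ Finset.univ) => hi i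
  have h2 : ∑ i, ((∑ ω, g ω * h i ω) / 2 - 1)
      = (∑ i, ∑ ω, g ω * h i ω) / 2 - Fintype.card ι := by
    rw [Finset.sum_sub_distrib, ← Finset.sum_div]
    simp
  linarith

/-! ### Products of Bernoulli laws -/

/-- The probability mass function of `Ber(t)`. -/
def berMass (t : ℝ) (x : Fin 2) : ℝ := if x = 1 then t else 1 - t

/-- The Kullback–Leibler divergence of `Ber(s)` from `Ber(t)`. It is meant for the absolutely
continuous case, where the junk values of `log` are multiplied by `0`. -/
noncomputable def klBer (s t : ℝ) : ℝ :=
  s * Real.log (s / t) + (1 - s) * Real.log ((1 - s) / (1 - t))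

theorem berMass_nonneg {t : ℝ} (h0 : 0 ≤ t) (h1 : t ≤ 1) (x : Fin 2) : 0 ≤ berMass t x := by
  unfold berMass; split_ifs <;> linarith

theorem sum_berMass (t : ℝ) : ∑ x, berMass t x = 1 := by
  simp [Fin.sum_univ_two, berMass]

theorem sum_prod_berMass {E : Type*} [Fintype E] [DecidableEq E] (s : E → ℝ) :
    ∑ ω : E → Fin 2, ∏ e, berMass (s e) (ω e) = 1 := by
  rw [← Fintype.piFinset_univ, ← Finset.prod_univ_sum]
  exact Finset.prod_eq_one fun e _ => sum_berMass _

theorem sum_prod_berMass_mul {E : Type*} [Fintype E] [DecidableEq E] (s : E → ℝ) (e₀ : E)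
    (u : Fin 2 → ℝ) :
    ∑ ω : E → Fin 2, (∏ e, berMass (s e) (ω e)) * u (ω e₀) = ∑ x, berMass (s e₀) x * u x := by
  have h : ∀ ω : E → Fin 2, (∏ e, berMass (s e) (ω e)) * u (ω e₀)
      = ∏ e, berMass (s e) (ω e) * (if e = e₀ then u (ω e) else 1) := by
    intro ω
    rw [Finset.prod_mul_distrib, Finset.prod_ite_eq' Finset.univ e₀ (fun e => u (ω e))]
    simp
  rw [Finset.sum_congr rfl fun ω _ => h ω, ← Fintype.piFinset_univ,
    ← Finset.prod_univ_sum (fun _ => Finset.univ)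
      (fun e x => berMass (s e) x * (if e = e₀ then u x else 1)),
    Finset.prod_eq_single e₀]
  · simp
  · intro e _ he
    simpa only [if_neg he, mul_one] using sum_berMass (s e)
  · simp

theorem berMass_mul_exp_le {s t : ℝ} (hs : 0 ≤ s ∧ s ≤ 1) (ht : 0 ≤ t ∧ t < 1)
    (hac : t = 0 → s = 0) (x : Fin 2) :
    berMass s x * Real.exp (-Real.log (berMass s x / berMass t x)) ≤ berMass t x := by
  have ht0 := berMass_nonneg ht.1 ht.2.le x
  rcases (berMass_nonneg hs.1 hs.2 x).eq_or_lt with h | h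
  · rw [← h, zero_mul]; exact ht0
  · have hpos : 0 < berMass t x := by
      refine lt_of_le_of_ne ht0 fun h' => ?_
      unfold berMass at h h'
      split_ifs at h h'
      · rw [hac h'.symm] at h; exact lt_irrefl _ h
      · linarith
    rw [← Real.log_inv, Real.exp_log (by positivity), inv_div, mul_div_cancel₀ _ h.ne']

instance (t : ℝ) : IsFiniteMeasure (ber t) := by
  constructor
  simp [ber]

theorem ber_singleton (t : ℝ) (x : Fin 2) : ber t {x} = ENNReal.ofReal (berMass t x) := by
  fin_cases x <;> simp [ber, berMass]

theorem edgeProb_mem {n r : ℕ} {p : Fin r → ℝ} {q : ℝ} (hq : 0 ≤ q ∧ q ≤ 1)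
    (hp : ∀ k, 0 ≤ p k ∧ p k ≤ 1) (z : Assignment n r) (i j : Fin n) :
    0 ≤ edgeProb p q z i j ∧ edgeProb p q z i j ≤ 1 := by
  unfold edgeProb
  split
  · exact hq
  · split_ifs
    · exact hp _
    · exact hq

/-- Fano's inequality for the block model, with a product of Bernoulli laws as reference measure.
The `z i` range over a family of assignments in which no clustering matrix has frequency above
`1 / M`. -/
theorem half_le_minimaxError {n r : ℕ} {N : Fin r → ℕ} {p : Fin r → ℝ} {q : ℝ}
    (hq : 0 ≤ q ∧ q ≤ 1) (hp : ∀ k, 0 ≤ p k ∧ p k ≤ 1)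
    {ι : Type*} [Fintype ι] [Nonempty ι] (z : ι → Assignment n r)
    (hz : ∀ i, z i ∈ assignments n N) (t : Pair n → ℝ) (ht : ∀ e, 0 ≤ t e ∧ t e < 1)
    (hac : ∀ i e, t e = 0 → edgeProb p q (z i) e.1.1 e.1.2 = 0) {M K : ℝ} (hM1 : 1 < M)
    (hM : ∀ y, ((Finset.univ.filter fun i => clusteringMatrix (z i) = y).card : ℝ) * M
      ≤ Fintype.card ι)
    (hK : ∀ i, ∑ e : Pair n, klBer (edgeProb p q (z i) e.1.1 e.1.2) (t e) ≤ K)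
    (hKM : 2 * K + 2 * Real.log 2 ≤ Real.log M) :
    1 / 2 ≤ minimaxError n N p q := by
  classical
  refine le_iInf fun Yhat => ?_
  let s : ι → Pair n → ℝ := fun i e => edgeProb p q (z i) e.1.1 e.1.2
  have hs : ∀ i e, 0 ≤ s i e ∧ s i e ≤ 1 := fun i e => edgeProb_mem hq hp _ _ _
  let f : ι → (Pair n → Fin 2) → ℝ := fun i ω => ∏ e, berMass (s i e) (ω e)
  have hf : ∀ i ω, 0 ≤ f i ω := fun i ω =>
    Finset.prod_nonneg fun e _ => berMass_nonneg (hs i e).1 (hs i e).2 _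
  obtain ⟨i, hi⟩ := exists_mul_success_le f
    (fun i ω => ∑ e, Real.log (berMass (s i e) (ω e) / berMass (t e) (ω e)))
    (fun ω => ∏ e, berMass (t e) (ω e)) hf (fun i => sum_prod_berMass _)
    (fun ω => Finset.prod_nonneg fun e _ => berMass_nonneg (ht e).1 (ht e).2.le _)
    (sum_prod_berMass _)
    (fun i ω => by
      rw [← Finset.sum_neg_distrib, Real.exp_sum, ← Finset.prod_mul_distrib]
      exact Finset.prod_le_prod
        (fun e _ => mul_nonneg (berMass_nonneg (hs i e).1 (hs i e).2 _) (Real.exp_pos _).le)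
        (fun e _ => berMass_mul_exp_le (hs i e) (ht e) (hac i e) _))
    (fun i => clusteringMatrix (z i)) (fun ω => Yhat (adjacency ω)) hM1.le hM
    (K := K) (fun i => by
      refine le_trans (le_of_eq ?_) (hK i)
      simp_rw [Finset.mul_sum]
      rw [Finset.sum_comm]
      refine Finset.sum_congr rfl fun e _ => ?_
      rw [sum_prod_berMass_mul (s i) e
        (fun x => Real.log (berMass (s i e) x / berMass (t e) x)), Fin.sum_univ_two]
      simp [berMass, klBer, s, add_comm])
  have hlog : 0 < Real.log M := Real.log_pos hM1
  have hsucc : ∑ ω with Yhat (adjacency ω) = clusteringMatrix (z i), f i ω ≤ 1 / 2 := by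
    by_contra! hlt
    nlinarith [mul_lt_mul_of_pos_left hlt hlog]
  have hfail : 1 / 2 ≤ ∑ ω with ¬ Yhat (adjacency ω) = clusteringMatrix (z i), f i ω := by
    have h1 := Finset.sum_filter_add_sum_filter_not Finset.univ
      (fun ω => Yhat (adjacency ω) = clusteringMatrix (z i)) (f i)
    have h2 : ∑ ω, f i ω = 1 := sum_prod_berMass _
    linarith
  refine le_trans ?_ (le_iSup₂ (f := fun z (_ : z ∈ assignments n N) => errorProb p q Yhat z)
    (z i) (hz i))
  have h1 : errorProb p q Yhat (z i)
      = ∑ ω with ¬ Yhat (adjacency ω) = clusteringMatrix (z i), ENNReal.ofReal (f i ω) := by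
    have h2 : ∀ ω, edgeLaw p q (z i) {ω} = ENNReal.ofReal (f i ω) := fun ω => by
      rw [edgeLaw, Measure.pi_singleton]
      simp_rw [ber_singleton]
      rw [ENNReal.ofReal_prod_of_nonneg
        fun e _ => berMass_nonneg (hs i e).1 (hs i e).2 _]
    simp_rw [← h2]
    rw [sum_measure_singleton, errorProb]
    congr 1
    ext ω
    simp
  rw [h1, ← ENNReal.ofReal_sum_of_nonneg fun ω _ => hf i ω]
  refine le_trans (le_of_eq ?_) (ENNReal.ofReal_le_ofReal hfail)
  rw [ENNReal.ofReal_div_of_pos (by norm_num)]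
  simp

/-! ### Counting clustering matrices -/

theorem clusteringMatrix_apply_eq_one {n r : ℕ} (z : Assignment n r) (i j : Fin n) :
    clusteringMatrix z i j = 1 ↔ ∃ k, z i = some k ∧ z j = some k := by
  simp [clusteringMatrix]

theorem clusteringMatrix_eq_iff {n r : ℕ} {z z' : Assignment n r}
    (h : clusteringMatrix z = clusteringMatrix z') (i j : Fin n) :
    (∃ k, z i = some k ∧ z j = some k) ↔ ∃ k, z' i = some k ∧ z' j = some k := by
  rw [← clusteringMatrix_apply_eq_one, h, clusteringMatrix_apply_eq_one]

/-- A clustering matrix determines the assignment up to a relabelling of the communities. -/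
theorem exists_perm_of_clusteringMatrix_eq {n r : ℕ} {N : Fin r → ℕ} (hN : ∀ k, 1 ≤ N k)
    {z z' : Assignment n r} (hz : z ∈ assignments n N)
    (h : clusteringMatrix z = clusteringMatrix z') :
    ∃ τ : Equiv.Perm (Fin r), z' = fun i => (z i).map τ := by
  have hrep : ∀ k, ∃ i, z i = some k := fun k => by
    have : 0 < (Finset.univ.filter fun i => z i = some k).card := by rw [hz k]; exact hN k
    obtain ⟨i, hi⟩ := Finset.card_pos.mp this
    exact ⟨i, by simpa using hi⟩
  choose a ha using hrep
  have hτ : ∀ k, ∃ l, z' (a k) = some l := fun k => by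
    obtain ⟨l, hl, -⟩ := (clusteringMatrix_eq_iff h (a k) (a k)).mp ⟨k, ha k, ha k⟩
    exact ⟨l, hl⟩
  choose τ hτ using hτ
  have hinj : Function.Injective τ := by
    intro k l hkl
    obtain ⟨m, h1, h2⟩ := (clusteringMatrix_eq_iff h (a k) (a l)).mpr
      ⟨τ k, hτ k, by rw [hkl]; exact hτ l⟩
    rw [ha] at h1 h2
    exact Option.some_injective _ (h1.trans h2.symm)
  refine ⟨Equiv.ofBijective τ (Finite.injective_iff_bijective.mp hinj), funext fun i => ?_⟩
  cases hi : z i with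
  | none =>
    cases hi' : z' i with
    | none => rfl
    | some l =>
      obtain ⟨k, hk, -⟩ := (clusteringMatrix_eq_iff h i i).mpr ⟨l, hi', hi'⟩
      rw [hi] at hk
      cases hk
  | some k =>
    obtain ⟨l, h1, h2⟩ := (clusteringMatrix_eq_iff h i (a k)).mp ⟨k, hi, ha k⟩
    rw [hτ] at h2
    rw [h1, ← h2]
    rfl

/-- The permutations in question form a coset of the stabilizer of `z`, or there are none. -/
theorem card_perm_comp_eq_le {α κ : Type*} [Fintype α] [DecidableEq α] [Fintype κ] [DecidableEq κ]
    (z w : α → κ) :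
    (Finset.univ.filter fun σ : Equiv.Perm α => z ∘ σ = w).card
      ≤ ∏ k, (Finset.univ.filter fun a => z a = k).card.factorial := by
  rcases (Finset.univ.filter fun σ : Equiv.Perm α => z ∘ σ = w).eq_empty_or_nonempty with h | h
  · rw [h]; simp
  obtain ⟨σ₁, h1⟩ := h
  have h1 : z ∘ σ₁ = w := by simpa using h1
  have h2 := DomMulAct.stabilizer_card z
  simp_rw [Fintype.card_subtype] at h2
  rw [← h2]
  refine Finset.card_le_card_of_injOn (fun σ => σ * σ₁⁻¹) ?_ (mul_left_injective _).injOn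
  intro σ hσ
  have hσ : z ∘ σ = w := by simpa using hσ
  simp only [Finset.coe_filter, Finset.mem_univ, true_and, Set.mem_ofPred_eq]
  funext a
  have := congrFun (hσ.trans h1.symm) (σ₁⁻¹ a)
  simpa using this

theorem card_isolated {n r : ℕ} {N : Fin r → ℕ} {z : Assignment n r} (hz : z ∈ assignments n N) :
    (Finset.univ.filter fun i => z i = none).card + ∑ k, N k = n := by
  have h := Finset.card_eq_sum_card_fiberwise (f := z) (s := Finset.univ) (t := Finset.univ)
    (fun _ _ => Finset.mem_coe.mpr (Finset.mem_univ _))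
  rw [Fintype.sum_option, Finset.card_univ, Fintype.card_fin,
    Finset.sum_congr rfl fun k _ => hz k] at h
  exact h.symm

theorem card_perm_clusteringMatrix_le {n r : ℕ} {N : Fin r → ℕ} (hN : ∀ k, 1 ≤ N k)
    {z : Assignment n r} (hz : ∀ σ : Equiv.Perm (Fin n), z ∘ σ ∈ assignments n N)
    (y : Matrix (Fin n) (Fin n) (Fin 2)) :
    (Finset.univ.filter fun σ : Equiv.Perm (Fin n) => clusteringMatrix (z ∘ σ) = y).card
      ≤ r.factorial * ((n - ∑ k, N k).factorial * ∏ k, (N k).factorial) := by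
  classical
  rcases (Finset.univ.filter fun σ : Equiv.Perm (Fin n) =>
    clusteringMatrix (z ∘ σ) = y).eq_empty_or_nonempty with h | ⟨σ₀, h0⟩
  · rw [h]; simp
  have h0 : clusteringMatrix (z ∘ σ₀) = y := by simpa using h0
  have hz0 : z ∈ assignments n N := hz 1
  have hsub : (Finset.univ.filter fun σ : Equiv.Perm (Fin n) => clusteringMatrix (z ∘ σ) = y)
      ⊆ (Finset.univ : Finset (Equiv.Perm (Fin r))).biUnion fun τ =>
        Finset.univ.filter fun σ : Equiv.Perm (Fin n) =>
          z ∘ σ = fun i => ((z ∘ σ₀) i).map τ := by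
    intro σ hσ
    have hσ : clusteringMatrix (z ∘ σ) = y := by simpa using hσ
    obtain ⟨τ, hτ⟩ := exists_perm_of_clusteringMatrix_eq hN (hz σ₀) (h0.trans hσ.symm)
    simp only [Finset.mem_biUnion, Finset.mem_univ, true_and, Finset.mem_filter]
    exact ⟨τ, hτ⟩
  refine (Finset.card_le_card hsub).trans ?_
  refine (Finset.card_biUnion_le_card_mul _ _ _ fun τ _ => card_perm_comp_eq_le z _).trans ?_
  rw [Finset.card_univ, Fintype.card_perm, Fintype.card_fin, Fintype.prod_option,
    Finset.prod_congr rfl fun k _ => congrArg Nat.factorial (hz0 k)]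
  have h3 := card_isolated hz0
  rw [show (Finset.univ.filter fun i => z i = none).card = n - ∑ k, N k by omega]

theorem comp_mem_assignments {n r : ℕ} {N : Fin r → ℕ} {z : Assignment n r}
    (hz : z ∈ assignments n N) (σ : Equiv.Perm (Fin n)) : z ∘ σ ∈ assignments n N := by
  intro k
  rw [← hz k]
  exact Finset.card_bij (fun i _ => σ i) (by simp) (by simp)
    (fun b hb => ⟨σ⁻¹ b, by simpa using hb, by simp⟩)

theorem exists_mem_assignments {n r : ℕ} {N : Fin r → ℕ} (hn : ∑ k, N k ≤ n) :
    ∃ z : Assignment n r, z ∈ assignments n N := by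
  classical
  obtain ⟨g⟩ : Nonempty ((Σ k, Fin (N k)) ↪ Fin n) :=
    Function.Embedding.nonempty_of_card_le (by simpa using hn)
  refine ⟨fun i => if h : ∃ a, g a = i then some h.choose.1 else none, fun k => ?_⟩
  have hval : ∀ a, (if h : ∃ b, g b = g a then some h.choose.1 else none) = some a.1 := by
    intro a
    have h : ∃ b, g b = g a := ⟨a, rfl⟩
    rw [dif_pos h, g.injective h.choose_spec]
  have : (Finset.univ.filter fun i =>
      (if h : ∃ a, g a = i then some h.choose.1 else none) = some k)
      = (Finset.univ : Finset (Fin (N k))).map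
        ⟨fun x => g ⟨k, x⟩, fun x y h => by simpa using g.injective h⟩ := by
    ext i
    simp only [Finset.mem_filter, Finset.mem_univ, true_and, Finset.mem_map]
    constructor
    · intro h
      split_ifs at h with h'
      obtain ⟨⟨l, x⟩, rfl⟩ := h'
      have := (hval ⟨l, x⟩).symm.trans ((dif_pos ⟨⟨l, x⟩, rfl⟩).trans h)
      obtain rfl : l = k := by simpa using this
      exact ⟨x, rfl⟩
    · rintro ⟨x, rfl⟩
      exact hval ⟨k, x⟩
  rw [this, Finset.card_map, Finset.card_univ, Fintype.card_fin]

/-! ### Factorial estimates -/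

theorem two_pow_mul_factorial_le (n : ℕ) (hn : 1 ≤ n) :
    (2 : ℝ) ^ n * n.factorial ≤ 2 * (n : ℝ) ^ n := by
  induction n, hn using Nat.le_induction with
  | base => simp
  | succ n hn ih =>
    have hpos : (0 : ℝ) < n := by exact_mod_cast hn
    have h1 : 2 * (n : ℝ) ^ n ≤ ((n : ℝ) + 1) ^ n := by
      have h2 := one_add_mul_le_pow (a := 1 / (n : ℝ))
        (le_trans (by norm_num) (by positivity : (0 : ℝ) ≤ 1 / n)) n
      rw [mul_one_div_cancel hpos.ne'] at h2
      calc 2 * (n : ℝ) ^ n ≤ (1 + 1 / (n : ℝ)) ^ n * (n : ℝ) ^ n := by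
            gcongr; linarith
        _ = ((n : ℝ) + 1) ^ n := by
            rw [← mul_pow]; congr 1; field_simp
    rw [Nat.factorial_succ]
    push_cast
    calc (2 : ℝ) ^ (n + 1) * ((n + 1) * n.factorial)
        = 2 * (n + 1) * (2 ^ n * n.factorial) := by ring
      _ ≤ 2 * (n + 1) * (((n : ℝ) + 1) ^ n) := by gcongr; linarith
      _ = _ := by ring

theorem log_factorial_le (n : ℕ) (hn : 1 ≤ n) :
    Real.log n.factorial ≤ n * Real.log n - (n - 1) * Real.log 2 := by
  have h := two_pow_mul_factorial_le n hn
  have hpos : (0 : ℝ) < n := by exact_mod_cast hn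
  have hf : (0 : ℝ) < n.factorial := by exact_mod_cast n.factorial_pos
  have h1 := Real.log_le_log (by positivity) h
  rw [Real.log_mul (by positivity) hf.ne', Real.log_mul (by norm_num) (by positivity),
    Real.log_pow, Real.log_pow] at h1
  linarith

theorem pow_le_exp_mul_descFactorial (n m : ℕ) (hm : m ≤ n) :
    (n : ℝ) ^ m ≤ Real.exp m * n.descFactorial m := by
  induction n generalizing m with
  | zero => obtain rfl : m = 0 := by omega
            simp
  | succ n ih =>
    rcases m with - | m
    · simp
    have ih := ih m (by omega)
    have h1 : ((n : ℝ) + 1) ^ m ≤ Real.exp 1 * (n : ℝ) ^ m := by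
      rcases Nat.eq_zero_or_pos n with rfl | hn
      · obtain rfl : m = 0 := by omega
        simp
      have hpos : (0 : ℝ) < n := by exact_mod_cast hn
      have h2 : (n : ℝ) + 1 ≤ Real.exp (1 / n) * n := by
        have := Real.add_one_le_exp (1 / (n : ℝ))
        calc (n : ℝ) + 1 = (1 / n + 1) * n := by field_simp; ring
          _ ≤ _ := by gcongr
      calc ((n : ℝ) + 1) ^ m ≤ (Real.exp (1 / n) * n) ^ m := by gcongr
        _ = Real.exp (m * (1 / n)) * (n : ℝ) ^ m := by rw [mul_pow, ← Real.exp_nat_mul]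
        _ ≤ _ := by
          gcongr
          rw [mul_one_div, div_le_one hpos]
          exact_mod_cast (by omega : m ≤ n)
    rw [Nat.succ_descFactorial_succ]
    push_cast
    rw [Real.exp_add]
    calc ((n : ℝ) + 1) ^ (m + 1) = (n + 1) * ((n : ℝ) + 1) ^ m := by ring
      _ ≤ (n + 1) * (Real.exp 1 * (Real.exp m * n.descFactorial m)) := by
          gcongr
          exact h1.trans (by gcongr)
      _ = _ := by ring

theorem log_factorial_sub_ge {n m : ℕ} (hm : m ≤ n) (hn : 1 ≤ n) :
    m * Real.log n - m ≤ Real.log n.factorial - Real.log (n - m).factorial := by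
  have h := pow_le_exp_mul_descFactorial n m hm
  have hpos : (0 : ℝ) < n := by exact_mod_cast hn
  have hd : (0 : ℝ) < n.descFactorial m := by exact_mod_cast Nat.descFactorial_pos.mpr hm
  have hf : (0 : ℝ) < (n - m).factorial := by exact_mod_cast (n - m).factorial_pos
  have h1 := Real.log_le_log (by positivity) h
  rw [Real.log_mul (by positivity) hd.ne', Real.log_exp, Real.log_pow] at h1
  rw [← Nat.factorial_mul_descFactorial hm, Nat.cast_mul, Real.log_mul hf.ne' hd.ne']
  linarith

/-- The inequality of arithmetic and geometric means in the form `∏ N k ≤ (n / r) ^ r`. With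
`N k ≥ 2` it shows that the factor `r!` lost to relabelling the communities costs at most half of
`∑ N k log (n / N k)`. -/
theorem mul_log_le_sum_log_div {n r : ℕ} (hr : 1 ≤ r) {N : Fin r → ℕ} (hN : ∀ k, 1 ≤ N k)
    (hn : ∑ k, N k ≤ n) : r * Real.log r ≤ ∑ k, Real.log ((n : ℝ) / N k) := by
  have hr0 : (0 : ℝ) < r := by exact_mod_cast hr
  have hN0 : ∀ k, (0 : ℝ) < N k := fun k => by exact_mod_cast hN k
  have hsum : ∑ k, (N k : ℝ) ≤ n := by exact_mod_cast hn
  have hn0 : (0 : ℝ) < n := lt_of_lt_of_le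
    (Finset.sum_pos (fun k _ => hN0 k) ⟨⟨0, hr⟩, Finset.mem_univ _⟩) hsum
  have h1 : ∀ k, Real.log r - Real.log ((n : ℝ) / N k) ≤ N k * (r / n) - 1 := by
    intro k
    have h2 : (0 : ℝ) < N k * (r / n) := by have := hN0 k; positivity
    have h3 := Real.log_le_sub_one_of_pos h2
    rw [Real.log_mul (hN0 k).ne' (by positivity), Real.log_div hr0.ne' hn0.ne'] at h3
    rw [Real.log_div hn0.ne' (hN0 k).ne']
    linarith
  have h4 := Finset.sum_le_sum fun k (_ : k ∈ Finset.univ) => h1 k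
  simp only [Finset.sum_sub_distrib, ← Finset.sum_mul, Finset.sum_const, Finset.card_univ,
    Fintype.card_fin, nsmul_eq_mul, mul_one] at h4
  have h5 : (∑ k, (N k : ℝ)) * (r / n) ≤ r := by
    calc (∑ k, (N k : ℝ)) * (r / n) ≤ n * (r / n) := by gcongr
      _ = r := by field_simp
  linarith

/-- The number of clustering matrices is at least `n! / (r! n₀! ∏ N k !)`; this is the lower bound
on its logarithm that feeds Fano's inequality. -/
theorem log_card_clusterings_ge {n r : ℕ} (hr : 1 ≤ r) {N : Fin r → ℕ}
    (hN : ∀ k, 2 ≤ N k ∧ (N k : ℝ) ≤ n / Real.exp 1) (hn : ∑ k, N k ≤ n) :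
    1 / 2 * ∑ k, (N k : ℝ) * Real.log (n / N k) - r - 2 + 2 * Real.log 2
      ≤ Real.log ((n.factorial : ℝ)
        / (r.factorial * ((n - ∑ k, N k).factorial * ∏ k, (N k).factorial) : ℕ)) := by
  have hN1 : ∀ k, 1 ≤ N k := fun k => le_trans (by norm_num) (hN k).1
  have hN2 : ∀ k, (2 : ℝ) ≤ N k := fun k => by exact_mod_cast (hN k).1
  have hn1 : 1 ≤ n := ((hN1 ⟨0, hr⟩).trans
    (Finset.single_le_sum (fun _ _ => Nat.zero_le _) (Finset.mem_univ _))).trans hn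
  have hn0 : (0 : ℝ) < n := by exact_mod_cast hn1
  have hx : ∀ k, 1 ≤ Real.log ((n : ℝ) / N k) := fun k => by
    have h0 : (0 : ℝ) < N k := by linarith [hN2 k]
    rw [Real.le_log_iff_exp_le (by positivity), le_div_iff₀ h0, mul_comm,
      ← le_div_iff₀ (Real.exp_pos 1)]
    exact (hN k).2
  have f0 : ∀ m : ℕ, (m.factorial : ℝ) ≠ 0 := fun m => by exact_mod_cast m.factorial_ne_zero
  push_cast
  rw [Real.log_div (f0 _) (mul_ne_zero (f0 _) (mul_ne_zero (f0 _)
      (Finset.prod_ne_zero_iff.mpr fun k _ => f0 _))),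
    Real.log_mul (f0 _) (mul_ne_zero (f0 _) (Finset.prod_ne_zero_iff.mpr fun k _ => f0 _)),
    Real.log_mul (f0 _) (Finset.prod_ne_zero_iff.mpr fun k _ => f0 _),
    Real.log_prod (fun k _ => f0 _)]
  have h1 := log_factorial_sub_ge hn hn1
  have h2 := log_factorial_le r hr
  have h3 := mul_log_le_sum_log_div hr hN1 hn
  have h4 : ∀ k, 1 / 2 * ((N k : ℝ) * Real.log (n / N k)) + Real.log ((n : ℝ) / N k)
        + Real.log (N k).factorial + (Real.log 2 - 2) ≤ N k * Real.log n - N k := by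
    intro k
    have h6 := log_factorial_le (N k) (hN1 k)
    have h7 := hx k
    have h8 := hN2 k
    have h9 := Real.log_two_gt_d9
    rw [Real.log_div hn0.ne' (by linarith)] at h7 ⊢
    nlinarith
  have h5 := Finset.sum_le_sum fun k (_ : k ∈ Finset.univ) => h4 k
  simp only [Finset.sum_add_distrib, Finset.sum_sub_distrib, ← Finset.mul_sum, ← Finset.sum_mul,
    Finset.sum_const, Finset.card_univ, Fintype.card_fin, nsmul_eq_mul] at h5
  push_cast at h1
  have hr1 : (1 : ℝ) ≤ r := by exact_mod_cast hr
  have h9 := Real.log_two_gt_d9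
  have h10 := Real.log_two_lt_d9
  nlinarith

/-! ### Sums over pairs of nodes -/

theorem two_mul_sum_pair_le {n : ℕ} (F : Fin n → Fin n → ℝ) (h0 : ∀ i j, 0 ≤ F i j)
    (hs : ∀ i j, F i j = F j i) :
    2 * ∑ e : Pair n, F e.1.1 e.1.2 ≤ ∑ i, ∑ j, F i j := by
  have h1 : ∑ e : Pair n, F e.1.1 e.1.2 = ∑ i, ∑ j, if i < j then F i j else 0 := by
    rw [← Fintype.sum_prod_type' (f := fun i j => if i < j then F i j else 0),
      ← Finset.sum_filter, ← Finset.sum_subtype_eq_sum_filter]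
    simp
  have h2 : ∑ i, ∑ j, (if i < j then F i j else 0) = ∑ i, ∑ j, if j < i then F i j else 0 := by
    rw [Finset.sum_comm]
    exact Finset.sum_congr rfl fun i _ => Finset.sum_congr rfl fun j _ => by rw [hs]
  rw [h1, two_mul]
  nth_rewrite 2 [h2]
  simp_rw [← Finset.sum_add_distrib]
  refine Finset.sum_le_sum fun i _ => Finset.sum_le_sum fun j _ => ?_
  rcases lt_trichotomy i j with h | h | h
  · simp [h, h.le.not_gt]
  · simp [h, h0]
  · simp [h, h.le.not_gt]

theorem edgeProb_comm {n r : ℕ} (p : Fin r → ℝ) (q : ℝ) (z : Assignment n r) (i j : Fin n) :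
    edgeProb p q z i j = edgeProb p q z j i := by
  unfold edgeProb
  cases hi : z i <;> cases hj : z j <;> simp
  rename_i k l
  by_cases h : k = l
  · simp [h]
  · simp [h, Ne.symm h]

theorem edgeProb_eq_or {n r : ℕ} (p : Fin r → ℝ) (q : ℝ) (z : Assignment n r) (i j : Fin n) :
    edgeProb p q z i j = q ∨ ∃ k, z i = some k ∧ z j = some k ∧ edgeProb p q z i j = p k := by
  unfold edgeProb
  cases hi : z i with
  | none => simp
  | some k =>
    by_cases h : z j = some k
    · right; exact ⟨k, rfl, h, by simp [h]⟩
    · left; simp [h]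

theorem sum_community {n r : ℕ} {N : Fin r → ℕ} {z : Assignment n r} (hz : z ∈ assignments n N)
    (c : Fin r → ℝ) :
    ∑ i, ∑ j, ∑ k, (if z i = some k ∧ z j = some k then c k else 0)
      = ∑ k, (N k : ℝ) ^ 2 * c k := by
  have h : ∀ k, ∑ i, ∑ j, (if z i = some k ∧ z j = some k then c k else 0)
      = (N k : ℝ) ^ 2 * c k := by
    intro k
    simp_rw [ite_and, Finset.sum_ite_irrel, Finset.sum_const_zero, ← Finset.sum_filter,
      Finset.sum_const, hz k, nsmul_eq_mul]
    ring
  rw [Finset.sum_congr rfl fun i _ => Finset.sum_comm, Finset.sum_comm,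
    Finset.sum_congr rfl fun k _ => h k]

theorem two_mul_sum_klBer_le {n r : ℕ} {N : Fin r → ℕ} {p : Fin r → ℝ} {q t : ℝ}
    {z : Assignment n r} (hz : z ∈ assignments n N) {c : Fin r → ℝ} {d : ℝ}
    (hc0 : ∀ k, 0 ≤ c k) (hd0 : 0 ≤ d) (hc : ∀ k, klBer (p k) t ≤ c k + d)
    (hd : klBer q t ≤ d) :
    2 * ∑ e : Pair n, klBer (edgeProb p q z e.1.1 e.1.2) t
      ≤ ∑ k, (N k : ℝ) ^ 2 * c k + n ^ 2 * d := by
  have hnn : ∀ i j : Fin n, 0 ≤ ∑ k, (if z i = some k ∧ z j = some k then c k else 0) :=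
    fun i j => Finset.sum_nonneg fun k _ => by split_ifs <;> simp [hc0]
  let F : Fin n → Fin n → ℝ := fun i j =>
    (∑ k, if z i = some k ∧ z j = some k then c k else 0) + d
  have hF : ∀ i j, klBer (edgeProb p q z i j) t ≤ F i j := by
    intro i j
    rcases edgeProb_eq_or p q z i j with h | ⟨k, hi, hj, h⟩
    · rw [h]; exact hd.trans (le_add_of_nonneg_left (hnn i j))
    · rw [h]
      refine (hc k).trans (add_le_add_left ?_ d)
      simp [hi, hj]
  have h1 := two_mul_sum_pair_le F (fun i j => add_nonneg (hnn i j) hd0)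
    (fun i j => by simp only [F, and_comm])
  have h2 : ∑ i, ∑ j, F i j = ∑ k, (N k : ℝ) ^ 2 * c k + n ^ 2 * d := by
    simp only [F, Finset.sum_add_distrib, sum_community hz]
    simp
    ring
  rw [← h2]
  refine le_trans ?_ h1
  gcongr
  exact hF _ _

/-! ### Divergence bounds -/

theorem mul_log_div_le {s t : ℝ} (hs : 0 ≤ s) (ht : 0 < t) :
    s * Real.log (s / t) ≤ s * (s / t - 1) := by
  rcases hs.eq_or_lt with rfl | hs
  · simp
  · exact mul_le_mul_of_nonneg_left (Real.log_le_sub_one_of_pos (by positivity)) hs.le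

theorem klBer_le_chiSq {s t : ℝ} (hs : 0 ≤ s ∧ s ≤ 1) (ht : 0 < t ∧ t < 1) :
    klBer s t ≤ chiSq s t := by
  have h0 := ht.1.ne'
  have h1 : 1 - t ≠ 0 := by linarith [ht.2]
  refine (add_le_add (mul_log_div_le hs.1 ht.1)
    (mul_log_div_le (sub_nonneg.mpr hs.2) (sub_pos.mpr ht.2))).trans (le_of_eq ?_)
  unfold chiSq
  field_simp
  ring

theorem chiSq_nonneg {s t : ℝ} (ht : 0 ≤ t ∧ t ≤ 1) : 0 ≤ chiSq s t :=
  div_nonneg (sq_nonneg _) (mul_nonneg ht.1 (sub_nonneg.mpr ht.2))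

theorem chiSq_self (s : ℝ) : chiSq s s = 0 := by simp [chiSq]

/-- The term `(t - q) / (1 - t)` accounts for the absent edges, uniformly in `s ≥ q`. -/
theorem klBer_le_of_mul_le {q s t w : ℝ} (hqs : q ≤ s) (hqt : q ≤ t) (hs : 0 ≤ s ∧ s ≤ 1)
    (ht1 : t < 1) (hw : 0 < w) (hst : s * w ≤ t) :
    klBer s t ≤ s * -Real.log w + (t - q) / (1 - t) := by
  have h1t : 0 < 1 - t := by linarith
  refine add_le_add ?_ ?_
  · rcases hs.1.eq_or_lt with h | h
    · simp [← h]
    · have ht : 0 < t := lt_of_lt_of_le (by positivity) hst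
      rw [← Real.log_inv]
      refine mul_le_mul_of_nonneg_left (Real.log_le_log (by positivity) ?_) h.le
      rw [div_le_iff₀ ht, inv_mul_eq_div, le_div_iff₀ hw]
      exact hst
  · refine (mul_log_div_le (sub_nonneg.mpr hs.2) h1t).trans ?_
    rw [le_div_iff₀ h1t]
    have : (1 - s) * ((1 - s) / (1 - t) - 1) * (1 - t) = (1 - s) * (t - s) := by
      field_simp
      ring
    rw [this]
    nlinarith [mul_nonneg hs.1 (sub_nonneg.mpr hqt), mul_nonneg (sub_nonneg.mpr hs.2)
      (sub_nonneg.mpr hqs)]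

/-! ### The family of all relabellings of the nodes -/

/-- The prior is uniform over all permutations of the nodes, and the reference measure makes all
edges present with the same probability `t`. -/
theorem half_le_minimaxError_of_klBer_le {n r : ℕ} {N : Fin r → ℕ} {p : Fin r → ℝ} {q : ℝ}
    (hr : 1 ≤ r) (hn : ∑ k, N k ≤ n) (hN : ∀ k, 2 ≤ N k ∧ (N k : ℝ) ≤ n / Real.exp 1)
    (hq : 0 ≤ q ∧ q ≤ 1) (hp : ∀ k, 0 ≤ p k ∧ p k ≤ 1) {t : ℝ} (ht : 0 ≤ t ∧ t < 1)
    (hac : t = 0 → q = 0 ∧ ∀ k, p k = 0) {c : Fin r → ℝ} {d : ℝ}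
    (hc0 : ∀ k, 0 ≤ c k) (hd0 : 0 ≤ d) (hc : ∀ k, klBer (p k) t ≤ c k + d)
    (hd : klBer q t ≤ d)
    (h : ∑ k, (N k : ℝ) ^ 2 * c k + n ^ 2 * d
      ≤ 1 / 2 * ∑ k, (N k : ℝ) * Real.log (n / N k) - r - 2) :
    1 / 2 ≤ minimaxError n N p q := by
  have hN1 : ∀ k, 1 ≤ N k := fun k => le_trans (by norm_num) (hN k).1
  obtain ⟨z, hz⟩ := exists_mem_assignments hn
  have hlog := log_card_clusterings_ge hr hN hn
  set D : ℕ := r.factorial * ((n - ∑ k, N k).factorial * ∏ k, (N k).factorial) with hD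
  have hD0 : (0 : ℝ) < D := by
    have : 0 < D := Nat.mul_pos r.factorial_pos (Nat.mul_pos (Nat.factorial_pos _)
      (Finset.prod_pos fun k _ => Nat.factorial_pos _))
    exact_mod_cast this
  have hf0 : (0 : ℝ) < n.factorial := by exact_mod_cast n.factorial_pos
  have hB0 : 0 ≤ ∑ k, (N k : ℝ) ^ 2 * c k + n ^ 2 * d :=
    add_nonneg (Finset.sum_nonneg fun k _ => mul_nonneg (sq_nonneg _) (hc0 k))
      (mul_nonneg (sq_nonneg _) hd0)
  have hl2 : 0 < Real.log 2 := Real.log_pos (by norm_num)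
  refine half_le_minimaxError hq hp (fun σ : Equiv.Perm (Fin n) => z ∘ σ)
    (comp_mem_assignments hz) (fun _ => t) (fun _ => ht) (fun σ e h0 => ?_)
    (M := n.factorial / D) (K := (∑ k, (N k : ℝ) ^ 2 * c k + n ^ 2 * d) / 2) ?_ (fun y => ?_)
    (fun σ => ?_) ?_
  · rcases edgeProb_eq_or p q (z ∘ σ) e.1.1 e.1.2 with h1 | ⟨k, -, -, h1⟩
    · rw [h1, (hac h0).1]
    · rw [h1, (hac h0).2]
  · rw [← Real.log_pos_iff (by positivity)]
    linarith
  · rw [Fintype.card_perm, Fintype.card_fin, ← mul_div_assoc, div_le_iff₀ hD0, mul_comm]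
    gcongr
    exact card_perm_clusteringMatrix_le hN1 (comp_mem_assignments hz) y
  · have := two_mul_sum_klBer_le (comp_mem_assignments hz σ) (p := p) hc0 hd0 hc hd
    linarith
  · linarith

theorem half_le_minimaxError_of_chiSq_le {n r : ℕ} {N : Fin r → ℕ} {p : Fin r → ℝ} {q : ℝ}
    (hr : 1 ≤ r) (hn : ∑ k, N k ≤ n) (hN : ∀ k, 2 ≤ N k ∧ (N k : ℝ) ≤ n / Real.exp 1)
    (hp : ∀ k, 0 ≤ p k ∧ p k ≤ 1) (hq : 0 < q ∧ q < 1)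
    (h : 4 * ∑ k, (N k : ℝ) ^ 2 * chiSq (p k) q
      ≤ 1 / 2 * ∑ k, (N k : ℝ) * Real.log (n / N k) - r - 2) :
    1 / 2 ≤ minimaxError n N p q := by
  have hq' : 0 ≤ q ∧ q ≤ 1 := ⟨hq.1.le, hq.2.le⟩
  have h0 : 0 ≤ ∑ k, (N k : ℝ) ^ 2 * chiSq (p k) q :=
    Finset.sum_nonneg fun k _ => mul_nonneg (sq_nonneg _) (chiSq_nonneg hq')
  refine half_le_minimaxError_of_klBer_le hr hn hN hq' hp ⟨hq.1.le, hq.2⟩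
    (fun h => absurd h hq.1.ne') (c := fun k => chiSq (p k) q) (fun k => chiSq_nonneg hq')
    le_rfl (fun k => by simpa using klBer_le_chiSq (hp k) hq)
    ((klBer_le_chiSq hq' hq).trans_eq (chiSq_self q)) ?_
  linarith

/-- The reference edge probability exceeds `q` by `∑ N k ^ 2 p k / n ^ 2`, roughly the density of the
edges inside the communities, which makes the divergence of `p k` from it at most logarithmic in `n / N k`. -/
theorem half_le_minimaxError_of_sparse {n r : ℕ} {N : Fin r → ℕ} {p : Fin r → ℝ} {q : ℝ}
    (hr : 1 ≤ r) (hn : ∑ k, N k ≤ n) (hN : ∀ k, 2 ≤ N k ∧ (N k : ℝ) ≤ n / Real.exp 1)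
    (hq : 0 ≤ q) (hqp : ∀ k, q ≤ p k) (hp : ∀ k, p k ≤ 1)
    (h : 2 * ∑ k, (N k : ℝ) ^ 2 * p k * (1 + Real.log (n / N k))
      ≤ 1 / 2 * ∑ k, (N k : ℝ) * Real.log (n / N k) - r - 2) :
    1 / 2 ≤ minimaxError n N p q := by
  have hp0 : ∀ k, 0 ≤ p k := fun k => hq.trans (hqp k)
  have hN2 : ∀ k, (2 : ℝ) ≤ N k := fun k => by exact_mod_cast (hN k).1
  have hN0 : ∀ k, (0 : ℝ) < N k := fun k => by linarith [hN2 k]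
  have hsum : ∑ k, (N k : ℝ) ≤ n := by exact_mod_cast hn
  have hrn : 2 * (r : ℝ) ≤ n := by
    refine le_trans ?_ hsum
    have := Finset.sum_le_sum fun k (_ : k ∈ Finset.univ) => hN2 k
    simpa [mul_comm] using this
  have hr1 : (1 : ℝ) ≤ r := by exact_mod_cast hr
  have hn0 : (0 : ℝ) < n := by linarith
  have hNn : ∀ k, (N k : ℝ) ≤ n := fun k =>
    (Finset.single_le_sum (fun k _ => (hN0 k).le) (Finset.mem_univ k)).trans hsum
  have hx0 : ∀ k, 0 ≤ Real.log ((n : ℝ) / N k) := fun k =>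
    Real.log_nonneg ((one_le_div (hN0 k)).mpr (hNn k))
  have hSn : ∑ k, (N k : ℝ) * Real.log (n / N k) ≤ r * n := by
    have h1 : ∀ k, (N k : ℝ) * Real.log (n / N k) ≤ n := fun k => by
      have h2 := Real.log_le_sub_one_of_pos (div_pos hn0 (hN0 k))
      calc (N k : ℝ) * Real.log (n / N k) ≤ N k * (n / N k) := by
            gcongr
            linarith
        _ = n := mul_div_cancel₀ _ (hN0 k).ne'
    refine (Finset.sum_le_sum fun k _ => h1 k).trans ?_
    simp
  -- comparing the terms of the hypothesis, `q` is at most `1 / 8`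
  have hq8 : q ≤ 1 / 8 := by
    by_contra! hlt
    have h1 : ∀ k, 1 / 4 * ((N k : ℝ) * Real.log (n / N k))
        ≤ (N k : ℝ) ^ 2 * p k * (1 + Real.log (n / N k)) := fun k => by
      have h2 : 1 / 8 ≤ p k := hlt.le.trans (hqp k)
      have h3 : (N k : ℝ) * (1 / 4) ≤ (N k : ℝ) ^ 2 * p k := by
        nlinarith [hN2 k, mul_nonneg (sq_nonneg (N k : ℝ)) (sub_nonneg.mpr h2)]
      nlinarith [hx0 k, hN0 k, mul_le_mul_of_nonneg_right h3 (hx0 k)]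
    have h2 := Finset.sum_le_sum fun k (_ : k ∈ Finset.univ) => h1 k
    rw [← Finset.mul_sum] at h2
    linarith
  set P : ℝ := ∑ k, (N k : ℝ) ^ 2 * p k with hP
  have hP0 : 0 ≤ P := Finset.sum_nonneg fun k _ => mul_nonneg (sq_nonneg _) (hp0 k)
  have hsplit : ∑ k, (N k : ℝ) ^ 2 * p k * (1 + Real.log (n / N k))
      = P + ∑ k, (N k : ℝ) ^ 2 * (p k * Real.log (n / N k)) := by
    rw [hP, ← Finset.sum_add_distrib]
    exact Finset.sum_congr rfl fun k _ => by ring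
  have hL0 : 0 ≤ ∑ k, (N k : ℝ) ^ 2 * (p k * Real.log (n / N k)) :=
    Finset.sum_nonneg fun k _ => mul_nonneg (sq_nonneg _) (mul_nonneg (hp0 k) (hx0 k))
  have hP8 : P / n ^ 2 ≤ 1 / 8 := by
    rw [div_le_iff₀ (by positivity)]
    nlinarith
  have hPn0 : 0 ≤ P / (n : ℝ) ^ 2 := by positivity
  set t : ℝ := q + P / n ^ 2 with ht
  have ht1 : t ≤ 1 / 4 := by linarith
  have hqt : q ≤ t := by linarith
  have ht0 : 0 ≤ t := hq.trans hqt
  have hw : ∀ k, p k * ((N k : ℝ) / n) ^ 2 ≤ t := fun k => by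
    have h1 : (N k : ℝ) ^ 2 * p k ≤ P :=
      Finset.single_le_sum (f := fun k => (N k : ℝ) ^ 2 * p k)
        (fun k _ => mul_nonneg (sq_nonneg _) (hp0 k)) (Finset.mem_univ k)
    calc p k * ((N k : ℝ) / n) ^ 2 = (N k : ℝ) ^ 2 * p k / n ^ 2 := by ring
      _ ≤ P / n ^ 2 := by gcongr
      _ ≤ t := by linarith
  refine half_le_minimaxError_of_klBer_le hr hn hN ⟨hq, by linarith⟩
    (fun k => ⟨hp0 k, hp k⟩) (t := t) ⟨ht0, by linarith⟩ (fun h0 => ?_)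
    (c := fun k => 2 * (p k * Real.log (n / N k))) (d := (t - q) / (1 - t))
    (fun k => mul_nonneg zero_le_two (mul_nonneg (hp0 k) (hx0 k)))
    (div_nonneg (by linarith) (by linarith)) (fun k => ?_) ?_ ?_
  · refine ⟨by linarith, fun k => ?_⟩
    have h1 := hw k
    have h2 : 0 < ((N k : ℝ) / n) ^ 2 := by have := hN0 k; positivity
    rw [h0] at h1
    exact le_antisymm (nonpos_of_mul_nonpos_left h1 h2) (hp0 k)
  · have h1 := klBer_le_of_mul_le (hqp k) hqt ⟨hp0 k, hp k⟩ (by linarith)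
      (by have := hN0 k; positivity) (hw k)
    rw [Real.log_pow, ← inv_div, Real.log_inv] at h1
    refine h1.trans (le_of_eq ?_)
    push_cast
    ring
  · simpa using klBer_le_of_mul_le le_rfl hqt ⟨hq, by linarith⟩ (by linarith) one_pos
      (by simpa using hqt)
  · have h1 : (n : ℝ) ^ 2 * ((t - q) / (1 - t)) ≤ 2 * P := by
      have h2 : (t - q) / (1 - t) ≤ 2 * (P / n ^ 2) := by
        rw [div_le_iff₀ (by linarith)]
        have : t - q = P / n ^ 2 := by rw [ht]; ring
        rw [this]
        nlinarith
      calc (n : ℝ) ^ 2 * ((t - q) / (1 - t)) ≤ n ^ 2 * (2 * (P / n ^ 2)) := by gcongr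
        _ = 2 * P := by field_simp
    have h2 : ∑ k, (N k : ℝ) ^ 2 * (2 * (p k * Real.log (n / N k)))
        = 2 * ∑ k, (N k : ℝ) ^ 2 * (p k * Real.log (n / N k)) := by
      rw [Finset.mul_sum]
      exact Finset.sum_congr rfl fun k _ => by ring
    rw [h2]
    linarith

/-! ### The family of transpositions at one node -/

theorem chiSq_add_chiSq_le {n r : ℕ} (p : Fin r → ℝ) (q : ℝ) (z : Assignment n r)
    (hc : ∀ k, 0 ≤ chiSq (p k) q + chiSq q (p k)) {v j : Fin n} (hvj : z v ≠ z j) (b : Fin n) :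
    chiSq (edgeProb p q z j b) (edgeProb p q z v b)
        + chiSq (edgeProb p q z v b) (edgeProb p q z j b)
      ≤ (∑ k, if z v = some k ∧ z b = some k then chiSq (p k) q + chiSq q (p k) else 0)
        + ∑ k, if z j = some k ∧ z b = some k then chiSq (p k) q + chiSq q (p k) else 0 := by
  have hnn : ∀ i, 0 ≤ ∑ k, if z i = some k ∧ z b = some k
      then chiSq (p k) q + chiSq q (p k) else 0 :=
    fun i => Finset.sum_nonneg fun k _ => by split_ifs; exacts [hc k, le_rfl]
  rcases edgeProb_eq_or p q z v b with hv | ⟨k, hv, hbv, hv'⟩ <;>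
    rcases edgeProb_eq_or p q z j b with hj | ⟨l, hj, hbj, hj'⟩
  · rw [hv, hj, chiSq_self]
    linarith [hnn v, hnn j]
  · have : ∑ k, (if z j = some k ∧ z b = some k then chiSq (p k) q + chiSq q (p k) else 0)
        = chiSq (p l) q + chiSq q (p l) := by simp [hj, hbj]
    rw [hv, hj', this]
    linarith [hnn v]
  · have : ∑ l, (if z v = some l ∧ z b = some l then chiSq (p l) q + chiSq q (p l) else 0)
        = chiSq (p k) q + chiSq q (p k) := by simp [hv, hbv]
    rw [hj, hv', this]
    linarith [hnn j]
  · exact absurd (by rw [hv, hj, ← hbv, ← hbj]) hvj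

theorem sum_community_row_le {n r : ℕ} {N : Fin r → ℕ} {z : Assignment n r}
    (hz : z ∈ assignments n N) {c : Fin r → ℝ} {C : ℝ} (hC0 : 0 ≤ C)
    (hC : ∀ k, (N k : ℝ) * c k ≤ C) (i : Fin n) :
    ∑ b, ∑ k, (if z i = some k ∧ z b = some k then c k else 0) ≤ C := by
  cases hi : z i with
  | none => simpa using hC0
  | some k =>
    have : ∀ b, ∑ l, (if some k = some l ∧ z b = some l then c l else 0)
        = if z b = some k then c k else 0 := fun b => by simp [ite_and]
    rw [Finset.sum_congr rfl fun b _ => this b, ← Finset.sum_filter, Finset.sum_const, hz k,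
      nsmul_eq_mul]
    exact hC k

/-- Exchanging two nodes only affects the edges at these nodes, so that it costs little
divergence. -/
theorem sum_klBer_swap_le {n r : ℕ} {N : Fin r → ℕ} {p : Fin r → ℝ} {q : ℝ} (hq : 0 < q ∧ q < 1)
    (hp : ∀ k, 0 < p k ∧ p k < 1) {z : Assignment n r} (hz : z ∈ assignments n N) {C : ℝ}
    (hC0 : 0 ≤ C) (hC : ∀ k, (N k : ℝ) * (chiSq (p k) q + chiSq q (p k)) ≤ C) {v j : Fin n}
    (hvj : z v ≠ z j) :
    ∑ e : Pair n, klBer (edgeProb p q (z ∘ Equiv.swap v j) e.1.1 e.1.2)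
      (edgeProb p q z e.1.1 e.1.2) ≤ 2 * C := by
  have hs : ∀ a b, 0 < edgeProb p q z a b ∧ edgeProb p q z a b < 1 := fun a b => by
    rcases edgeProb_eq_or p q z a b with h | ⟨k, -, -, h⟩ <;> rw [h]
    exacts [hq, hp k]
  have hchi : ∀ x a b, 0 ≤ chiSq x (edgeProb p q z a b) := fun x a b =>
    chiSq_nonneg ⟨(hs a b).1.le, (hs a b).2.le⟩
  set τ := Equiv.swap v j with hτ
  have hcomp : ∀ a b, edgeProb p q (z ∘ τ) a b = edgeProb p q z (τ a) (τ b) := fun _ _ => rfl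
  let F : Fin n → Fin n → ℝ := fun a b =>
    if a = b then 0 else chiSq (edgeProb p q z (τ a) (τ b)) (edgeProb p q z a b)
  let u : Fin n → ℝ := fun b => chiSq (edgeProb p q z j b) (edgeProb p q z v b)
  let w : Fin n → ℝ := fun b => chiSq (edgeProb p q z v b) (edgeProb p q z j b)
  -- `R` bounds the divergence along the rows of `v` and `j`, its transpose that along the columns
  let R : Fin n → Fin n → ℝ := fun a b => (if a = v then u b else 0) + if a = j then w b else 0
  have hR0 : ∀ a b, 0 ≤ R a b := fun a b =>
    add_nonneg (by split_ifs; exacts [hchi _ _ _, le_rfl])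
      (by split_ifs; exacts [hchi _ _ _, le_rfl])
  have hne : v ≠ j := fun h => hvj (by rw [h])
  have hFR' : ∀ a b, a = v ∨ a = j → F a b ≤ R a b := by
    intro a b ha
    by_cases hab : a = b
    · simpa [F, hab] using hR0 b b
    · simp only [F, if_neg hab]
      rcases ha with rfl | rfl
      · by_cases hb : b = j
        · rw [hb, hτ, Equiv.swap_apply_left, Equiv.swap_apply_right, edgeProb_comm, chiSq_self]
          exact hR0 _ _
        · rw [hτ, Equiv.swap_apply_left, Equiv.swap_apply_of_ne_of_ne (Ne.symm hab) hb]
          simp [R, u, hne]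
      · by_cases hb : b = v
        · rw [hb, hτ, Equiv.swap_apply_left, Equiv.swap_apply_right, edgeProb_comm, chiSq_self]
          exact hR0 _ _
        · rw [hτ, Equiv.swap_apply_right, Equiv.swap_apply_of_ne_of_ne hb (Ne.symm hab)]
          simp [R, w, hne.symm]
  have hF0 : ∀ a b, 0 ≤ F a b := fun a b => by
    dsimp only [F]; split_ifs; exacts [le_rfl, hchi _ _ _]
  have hFs : ∀ a b, F a b = F b a := fun a b => by
    dsimp only [F]
    rw [edgeProb_comm p q z (τ a), edgeProb_comm p q z a]
    simp only [eq_comm]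
  have hFR : ∀ a b, F a b ≤ R a b + R b a := by
    intro a b
    by_cases ha : a = v ∨ a = j
    · linarith [hFR' a b ha, hR0 b a]
    by_cases hb : b = v ∨ b = j
    · rw [hFs]; linarith [hFR' b a hb, hR0 a b]
    push Not at ha hb
    have : F a b = 0 := by
      dsimp only [F]
      rw [hτ, Equiv.swap_apply_of_ne_of_ne ha.1 ha.2, Equiv.swap_apply_of_ne_of_ne hb.1 hb.2,
        chiSq_self, ite_self]
    rw [this]
    exact add_nonneg (hR0 a b) (hR0 b a)
  have h1 := two_mul_sum_pair_le F hF0 hFs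
  have h2 : ∑ a, ∑ b, F a b ≤ 2 * ∑ b, (u b + w b) := by
    refine (Finset.sum_le_sum fun a _ => Finset.sum_le_sum fun b _ => hFR a b).trans
      (le_of_eq ?_)
    have h3 : ∑ a, ∑ b, R a b = ∑ b, (u b + w b) := by
      rw [Finset.sum_comm]
      exact Finset.sum_congr rfl fun b _ => by simp [R, Finset.sum_add_distrib]
    simp_rw [Finset.sum_add_distrib] at h3 ⊢
    rw [Finset.sum_comm (f := fun a b => R b a), h3]
    ring
  have h3 : ∑ b, (u b + w b) ≤ 2 * C := by
    have hc : ∀ k, 0 ≤ chiSq (p k) q + chiSq q (p k) := fun k =>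
      add_nonneg (chiSq_nonneg ⟨hq.1.le, hq.2.le⟩) (chiSq_nonneg ⟨(hp k).1.le, (hp k).2.le⟩)
    refine (Finset.sum_le_sum fun b _ => chiSq_add_chiSq_le p q z hc hvj b).trans ?_
    rw [Finset.sum_add_distrib]
    linarith [sum_community_row_le hz hC0 hC v, sum_community_row_le hz hC0 hC j]
  have h4 : ∑ e : Pair n, klBer (edgeProb p q (z ∘ τ) e.1.1 e.1.2) (edgeProb p q z e.1.1 e.1.2)
      ≤ ∑ e : Pair n, F e.1.1 e.1.2 := by
    refine Finset.sum_le_sum fun e _ => ?_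
    rw [hcomp]
    simp only [F, if_neg e.2.ne]
    exact klBer_le_chiSq ⟨(hs _ _).1.le, (hs _ _).2.le⟩ (hs _ _)
  linarith

open Classical in
/-- The community of a node, all communities with a single node being identified: two nodes have
the same value if and only if exchanging them does not change the clustering matrix. Here `N` must
be the sizes of the communities of `z`. -/
noncomputable def swapClass {n r : ℕ} (N : Fin r → ℕ) (z : Assignment n r) (i : Fin n) :
    Option (Option (Fin r)) :=
  if ∃ k, z i = some k ∧ N k = 1 then none else some (z i)

theorem swapClass_congr {n r : ℕ} (N : Fin r → ℕ) {z : Assignment n r} {i j : Fin n}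
    (h : z i = z j) : swapClass N z i = swapClass N z j := by
  unfold swapClass; rw [h]

theorem exists_ne_of_two_le {n r : ℕ} {N : Fin r → ℕ} {z : Assignment n r}
    (hz : z ∈ assignments n N) {k : Fin r} (hk : 2 ≤ N k) (i : Fin n) :
    ∃ w, w ≠ i ∧ z w = some k := by
  obtain ⟨w, hw, hne⟩ := Finset.exists_mem_ne (s := Finset.univ.filter fun i => z i = some k)
    (by rw [hz k]; omega) i
  exact ⟨w, hne, by simpa using hw⟩

/-- Exchanging a node `v` with distinct nodes of other classes yields distinct clustering
matrices. -/
theorem eq_of_clusteringMatrix_swap_eq {n r : ℕ} {N : Fin r → ℕ} (hN : ∀ k, 1 ≤ N k)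
    {z : Assignment n r} (hz : z ∈ assignments n N) {v j j' : Fin n}
    (hj : swapClass N z j ≠ swapClass N z v) (hj' : swapClass N z j' ≠ swapClass N z v)
    (h : clusteringMatrix (z ∘ Equiv.swap v j) = clusteringMatrix (z ∘ Equiv.swap v j')) :
    j = j' := by
  by_contra hne
  have hiff := clusteringMatrix_eq_iff h
  simp only [Function.comp_apply] at hiff
  have hjv : j ≠ v := fun h => hj (by rw [h])
  have hzj : z j ≠ z v := fun h => hj (swapClass_congr N h)
  have hzj' : z j' ≠ z v := fun h => hj' (swapClass_congr N h)
  have hτj' : Equiv.swap v j' j = j := Equiv.swap_apply_of_ne_of_ne hjv hne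
  cases hv : z v with
  | none =>
    have h1 := hiff j j
    rw [Equiv.swap_apply_right, hτj', hv] at h1
    cases hj0 : z j with
    | none => exact hzj (hj0.trans hv.symm)
    | some l => simp [hj0] at h1
  | some k =>
    rcases (hN k).eq_or_lt with hk | hk
    · cases hj0 : z j with
      | none =>
        have h1 := hiff j j
        rw [Equiv.swap_apply_right, hτj', hv, hj0] at h1
        simp at h1
      | some l =>
        have hkl : k ≠ l := fun h => hzj (by rw [hj0, hv, h])
        have hl : 2 ≤ N l := by
          refine (hN l).lt_of_ne fun hl => hj ?_
          unfold swapClass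
          rw [if_pos ⟨l, hj0, hl.symm⟩, if_pos ⟨k, hv, hk.symm⟩]
        obtain ⟨u, huj, hu⟩ := exists_ne_of_two_le hz hl j
        have huv : u ≠ v := fun h => hkl (by
          rw [h, hv] at hu
          exact Option.some_injective _ hu)
        by_cases huj' : u = j'
        · have h1 := hiff j v
          rw [Equiv.swap_apply_right, hτj', Equiv.swap_apply_left, Equiv.swap_apply_left, ← huj',
            hv, hj0, hu] at h1
          simp [hkl.symm] at h1
        · have h1 := hiff j u
          rw [Equiv.swap_apply_right, hτj', Equiv.swap_apply_of_ne_of_ne huv huj,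
            Equiv.swap_apply_of_ne_of_ne huv huj', hv, hj0, hu] at h1
          simp [hkl.symm] at h1
    · obtain ⟨w, hwv, hw⟩ := exists_ne_of_two_le hz hk v
      have hwj : w ≠ j := fun h => hzj (by rw [← h, hw, hv])
      have hwj' : w ≠ j' := fun h => hzj' (by rw [← h, hw, hv])
      have h1 := hiff j w
      rw [Equiv.swap_apply_right, hτj', Equiv.swap_apply_of_ne_of_ne hwv hwj,
        Equiv.swap_apply_of_ne_of_ne hwv hwj', hv, hw] at h1
      obtain ⟨m, h2, h3⟩ := h1.mp ⟨k, rfl, rfl⟩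
      exact hzj (by rw [h2, ← h3, hv])

theorem exists_swapClass_ne {n r : ℕ} {N : Fin r → ℕ} (hN : ∀ k, 1 ≤ N k) (hr : 2 ≤ r)
    (hrn : r < n) {z : Assignment n r} (hz : z ∈ assignments n N) :
    ∃ v w, swapClass N z v ≠ swapClass N z w := by
  by_contra! hall
  have hrep : ∀ k, ∃ i, z i = some k := fun k => by
    have : 0 < (Finset.univ.filter fun i => z i = some k).card := by rw [hz k]; exact hN k
    obtain ⟨i, hi⟩ := Finset.card_pos.mp this
    exact ⟨i, by simpa using hi⟩
  obtain ⟨a, ha⟩ := hrep ⟨0, by omega⟩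
  obtain ⟨b, hb⟩ := hrep ⟨1, by omega⟩
  have hab := hall a b
  have hone : ∃ k, z a = some k ∧ N k = 1 := by
    by_contra hcon
    unfold swapClass at hab
    rw [if_neg hcon] at hab
    split_ifs at hab
    rw [ha, hb] at hab
    simp at hab
  have hall1 : ∀ i, ∃ k, z i = some k ∧ N k = 1 := by
    intro i
    by_contra hcon
    have := hall a i
    unfold swapClass at this
    rw [if_pos hone, if_neg hcon] at this
    cases this
  -- then all communities are singletons and no node is isolated, so that `n ≤ r`
  have hinj : Function.Injective z := by
    intro i j hij
    obtain ⟨k, hk, hk1⟩ := hall1 i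
    have := hz k
    rw [hk1, Finset.card_eq_one] at this
    obtain ⟨x, hx⟩ := this
    have hi : i ∈ ({x} : Finset (Fin n)) := by rw [← hx]; simpa using hk
    have hj : j ∈ ({x} : Finset (Fin n)) := by rw [← hx]; simpa using hij ▸ hk
    rw [Finset.mem_singleton] at hi hj
    rw [hi, hj]
  choose g hg using fun i => hall1 i
  have hginj : Function.Injective g := fun i j hij => hinj (by rw [(hg i).1, (hg j).1, hij])
  have := Fintype.card_le_of_injective g hginj
  simp at this
  omega

theorem exists_two_mul_card_swapClass_le {n r : ℕ} {N : Fin r → ℕ} (hN : ∀ k, 1 ≤ N k)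
    (hr : 2 ≤ r) (hrn : r < n) {z : Assignment n r} (hz : z ∈ assignments n N) :
    ∃ v, n ≤ 2 * Fintype.card {j // swapClass N z j ≠ swapClass N z v} := by
  classical
  obtain ⟨v, w, hvw⟩ := exists_swapClass_ne hN hr hrn hz
  have h : n ≤ Fintype.card {j // swapClass N z j ≠ swapClass N z v}
      + Fintype.card {j // swapClass N z j ≠ swapClass N z w} := by
    rw [Fintype.card_subtype, Fintype.card_subtype]
    refine le_trans ?_ (Finset.card_union_le _ _)
    rw [Finset.eq_univ_of_forall (s := _ ∪ _) fun j => ?_, Finset.card_univ, Fintype.card_fin]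
    simp only [Finset.mem_union, Finset.mem_filter, Finset.mem_univ, true_and]
    by_contra! hj
    exact hvw (hj.1.symm.trans hj.2)
  by_contra! hcon
  have := hcon v
  have := hcon w
  omega

/-- The prior is uniform over the assignments obtained by exchanging a fixed node with the nodes of
other classes, and the reference measure is the law before the exchange. -/
theorem half_le_minimaxError_of_swap {n r : ℕ} {N : Fin r → ℕ} {p : Fin r → ℝ} {q : ℝ}
    (hN : ∀ k, 1 ≤ N k) (hn : ∑ k, N k ≤ n) (hn128 : 128 ≤ n) (hr : 2 ≤ r) (hrn : r < n)
    (hq : 0 < q) (hqp : ∀ k, q ≤ p k) (hp : ∀ k, p k < 1)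
    (hC : ∀ k, (N k : ℝ) * (chiSq (p k) q + chiSq q (p k)) ≤ 1 / 12 * Real.log n) :
    1 / 2 ≤ minimaxError n N p q := by
  classical
  have hq1 : q < 1 := (hqp ⟨0, by omega⟩).trans_lt (hp _)
  have hp' : ∀ k, 0 < p k ∧ p k < 1 := fun k => ⟨hq.trans_le (hqp k), hp k⟩
  have hn128' : (128 : ℝ) ≤ n := by exact_mod_cast hn128
  obtain ⟨z, hz⟩ := exists_mem_assignments hn
  obtain ⟨v, hv⟩ := exists_two_mul_card_swapClass_le hN hr hrn hz
  have hv' : (n : ℝ) ≤ 2 * Fintype.card {j // swapClass N z j ≠ swapClass N z v} := by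
    exact_mod_cast hv
  have : Nonempty {j // swapClass N z j ≠ swapClass N z v} :=
    Fintype.card_pos_iff.mp (by omega)
  refine half_le_minimaxError ⟨hq.le, hq1.le⟩ (fun k => ⟨(hp' k).1.le, (hp k).le⟩)
    (fun j : {j // swapClass N z j ≠ swapClass N z v} => z ∘ Equiv.swap v j.1)
    (fun j => comp_mem_assignments hz _) (fun e => edgeProb p q z e.1.1 e.1.2)
    (M := n / 2) (K := 2 * (1 / 12 * Real.log n)) (fun e => ?_) (fun j e h0 => ?_) (by linarith)
    (fun y => ?_) (fun j => ?_) ?_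
  · rcases edgeProb_eq_or p q z e.1.1 e.1.2 with h | ⟨k, -, -, h⟩ <;> rw [h]
    exacts [⟨hq.le, hq1⟩, ⟨(hp' k).1.le, hp k⟩]
  · rcases edgeProb_eq_or p q z e.1.1 e.1.2 with h | ⟨k, -, -, h⟩ <;> rw [h] at h0
    exacts [absurd h0 hq.ne', absurd h0 (hp' k).1.ne']
  · have h1 : (Finset.univ.filter fun j : {j // swapClass N z j ≠ swapClass N z v} =>
        clusteringMatrix (z ∘ Equiv.swap v j.1) = y).card ≤ 1 := by
      rw [Finset.card_le_one]
      intro a ha b hb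
      simp only [Finset.mem_filter, Finset.mem_univ, true_and] at ha hb
      exact Subtype.ext (eq_of_clusteringMatrix_swap_eq hN hz a.2 b.2 (ha.trans hb.symm))
    have h2 : ((Finset.univ.filter fun j : {j // swapClass N z j ≠ swapClass N z v} =>
        clusteringMatrix (z ∘ Equiv.swap v j.1) = y).card : ℝ) ≤ 1 := by exact_mod_cast h1
    nlinarith
  · exact sum_klBer_swap_le ⟨hq, hq1⟩ hp' hz
      (mul_nonneg (by norm_num) (Real.log_nonneg (by linarith))) hC
      fun h => j.2 (swapClass_congr N h.symm)
  · rw [Real.log_div (by linarith) (by norm_num)]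
    have h1 : 7 * Real.log 2 ≤ Real.log n := by
      have h2 := Real.log_le_log (by norm_num) hn128'
      rw [show (128 : ℝ) = 2 ^ 7 by norm_num, Real.log_pow] at h2
      exact_mod_cast h2
    have h2 : 0 < Real.log 2 := Real.log_pos (by norm_num)
    linarith

end HSBM

theorem theorem4 (n r : ℕ) (N : Fin r → ℕ) (p : Fin r → ℝ) (q : ℝ)
    (hr : 1 ≤ r) (hN : ∀ k, 1 ≤ N k) (hn : ∑ k, N k ≤ n)
    (hq : 0 ≤ q) (hqp : ∀ k, q ≤ p k) (hp : ∀ k, p k ≤ 1)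
    (hcond :
      ((∀ k, 2 ≤ N k ∧ (N k : ℝ) ≤ n / Real.exp 1) ∧ 0 < q ∧ q < 1 ∧
        4 * ∑ k, (N k : ℝ) ^ 2 * HSBM.chiSq (p k) q
          ≤ 1 / 2 * ∑ k, (N k : ℝ) * Real.log (n / N k) - r - 2)
      ∨ ((∀ k, 2 ≤ N k ∧ (N k : ℝ) ≤ n / Real.exp 1) ∧ (∀ k, p k < 1) ∧
        1 / 2 * (r : ℝ) + Real.log ((1 - ⨅ k, p k) / (1 - ⨆ k, p k)) + 1
            + ∑ k, (N k : ℝ) ^ 2 * p k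
          ≤ (1 / 4 * ∑ k, (N k : ℝ) - ∑ k, (N k : ℝ) ^ 2 * p k) * Real.log n
            + ∑ k, ((N k : ℝ) * p k - 1 / 4) * N k * Real.log (N k))
      ∨ (128 ≤ n ∧ 2 ≤ r ∧ r < n ∧ 0 < q ∧ (∀ k, p k < 1) ∧
        (⨆ k, (N k : ℝ) * (HSBM.chiSq (p k) q + HSBM.chiSq q (p k)))
          ≤ 1 / 12 * Real.log ((n : ℝ) - ((⨅ k, N k : ℕ) : ℝ)))) :
    1 / 2 ≤ HSBM.minimaxError n N p q := by
  have hp0 : ∀ k, 0 ≤ p k := fun k => hq.trans (hqp k)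
  have hN0 : ∀ k, (0 : ℝ) < N k := fun k => by exact_mod_cast hN k
  have hNn : ∀ k, N k ≤ n := fun k =>
    (Finset.single_le_sum (fun _ _ => Nat.zero_le _) (Finset.mem_univ k)).trans hn
  have : Nonempty (Fin r) := ⟨⟨0, hr⟩⟩
  rcases hcond with ⟨hN2, hq0, hq1, h⟩ | ⟨hN2, hp1, h⟩ | ⟨hn128, hr2, hrn, hq0, hp1, h⟩
  · exact HSBM.half_le_minimaxError_of_chiSq_le hr hn hN2 (fun k => ⟨hp0 k, hp k⟩) ⟨hq0, hq1⟩ h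
  · refine HSBM.half_le_minimaxError_of_sparse hr hn hN2 hq hqp hp ?_
    have hn0 : (0 : ℝ) < n := lt_of_lt_of_le (hN0 ⟨0, hr⟩) (by exact_mod_cast hNn _)
    have hratio : 0 ≤ Real.log ((1 - ⨅ k, p k) / (1 - ⨆ k, p k)) := by
      obtain ⟨k, hk⟩ := exists_eq_ciSup_of_finite (f := p)
      have h1 : ⨅ k, p k ≤ p k := ciInf_le (Set.finite_range p).bddBelow k
      refine Real.log_nonneg ?_
      rw [← hk, one_le_div (by linarith [hp1 k])]
      linarith
    have hsum : 1 / 4 * ∑ k, (N k : ℝ) * Real.log (n / N k)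
          - ∑ k, (N k : ℝ) ^ 2 * p k * (1 + Real.log (n / N k))
        = (1 / 4 * ∑ k, (N k : ℝ) - ∑ k, (N k : ℝ) ^ 2 * p k) * Real.log n
            + ∑ k, ((N k : ℝ) * p k - 1 / 4) * N k * Real.log (N k)
          - ∑ k, (N k : ℝ) ^ 2 * p k := by
      rw [Finset.mul_sum, Finset.mul_sum, ← Finset.sum_sub_distrib, ← Finset.sum_sub_distrib,
        Finset.sum_mul, ← Finset.sum_add_distrib, ← Finset.sum_sub_distrib]
      refine Finset.sum_congr rfl fun k _ => ?_
      rw [Real.log_div hn0.ne' (hN0 k).ne']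
      ring
    linarith
  · refine HSBM.half_le_minimaxError_of_swap hN hn hn128 hr2 hrn hq0 hqp hp1 fun k => ?_
    have h1 := le_ciSup (f := fun k => (N k : ℝ) * (HSBM.chiSq (p k) q + HSBM.chiSq q (p k)))
      (Set.finite_range _).bddAbove k
    have h2 : (⨅ k, N k) < n := by
      have h3 : (⨅ k, N k) ≤ N ⟨0, hr⟩ := ciInf_le (OrderBot.bddBelow _) _
      have h4 : ∑ k ∈ ({⟨0, hr⟩, ⟨1, hr2⟩} : Finset (Fin r)), N k ≤ ∑ k, N k :=
        Finset.sum_le_sum_of_subset (Finset.subset_univ _)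
      rw [Finset.sum_pair (by simp)] at h4
      have := hN ⟨1, hr2⟩
      omega
    have h3 : (((⨅ k, N k : ℕ) : ℝ)) < n := by exact_mod_cast h2
    have h4 : Real.log ((n : ℝ) - ((⨅ k, N k : ℕ) : ℝ)) ≤ Real.log n :=
      Real.log_le_log (by linarith) (by linarith [Nat.cast_nonneg (α := ℝ) (⨅ k, N k)])
    linarith
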